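/- Let $q\in\mathbb{C}$ with $q\neq 0$ and $|q|\neq 1$. For a meromorphic function $f$ on $\mathbb{C}$ put $$D_q^0f=f,\qquad D_qf(z)=\frac{f(qz)-f(z)}{qz-z},\qquad D_q^{k}f=D_q(D_q^{k-1}f)\quad(k\ge 1).$$ Let $m(r,f)=\frac1{2\pi}\int_0^{2\pi}\log^+|f(re^{i\theta})|\,d\theta$ be the Nevanlinna proximity function, and let $T(r,f)=m(r,f)+N(r,f)$ be the Nevanlinna characteristic, where $N(r,f)$ is the integrated counting function of the poles of $f$ with multiplicity. Let $f$ be a nonconstant meromorphic function on $\mathbb{C}$ of order zero, that is, $\limsup_{r\to\infty}\frac{\log T(r,f)}{\log r}=0$. Then for every integer $k\ge 0$ there is a measurable set $E\subseteq\mathbb{R}$ of logarithmic density $1$, that is, $$\lim_{r\to\infty}\frac{1}{\log r}\int_{E\cap[1,r]}\frac{dt}{t}=1,$$ such that $$m\Big(r,\frac{D_q^kf}{f}\Big)=o(T(r,f))\qquad\text{as } r\to\infty,\ r\in E.$$ -/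

import Mathlib

open Filter Topology MeasureTheory Asymptotics

noncomputable section

/-- The Jackson `q`-difference operator `D_q f (z) = (f (q z) - f z) / (q z - z)`.
A meromorphic function is represented by a function `ℂ → ℂ` whose values on a closed discrete set
(poles, removable singularities) are irrelevant; the value of `D_q f` at `0` is of this kind. -/
def jacksonDiff (q : ℂ) (f : ℂ → ℂ) : ℂ → ℂ :=
  fun z => (f (q * z) - f z) / (q * z - z)

/-- The Jackson difference operator of order `k`: `D_q^0 f = f`, `D_q^(k+1) f = D_q (D_q^k f)`. -/
def jacksonDiffIter (q : ℂ) : ℕ → (ℂ → ℂ) → ℂ → ℂ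
  | 0, f => f
  | k + 1, f => jacksonDiff q (jacksonDiffIter q k f)

/-- The proximity function `m(r, f) = (1 / 2π) ∫_0^{2π} log⁺ |f (r e^{iθ})| dθ`. -/
abbrev nevanlinnaProximity (f : ℂ → ℂ) : ℝ → ℝ :=
  ValueDistribution.proximity f ⊤

/-- The Nevanlinna characteristic `T(r, f) = m(r, f) + N(r, f)`, where `N(r, f)` is the logarithmic
(integrated) counting function of the poles of `f`, with multiplicity. -/
abbrev nevanlinnaCharacteristic (f : ℂ → ℂ) : ℝ → ℝ :=
  ValueDistribution.characteristic f ⊤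

/-- The order of growth `σ(f) = limsup_{r → ∞} log T(r, f) / log r`, as an extended real number. -/
def growthOrder (f : ℂ → ℂ) : EReal :=
  limsup (fun r : ℝ => ((Real.log (nevanlinnaCharacteristic f r) / Real.log r : ℝ) : EReal)) atTop

/-- `f` is constant as a meromorphic function: it agrees with a constant off a closed discrete
set. -/
def IsMeromorphicConst (f : ℂ → ℂ) : Prop :=
  ∃ c : ℂ, f =ᶠ[codiscrete ℂ] fun _ => c

/-- The measurable set `E ⊆ ℝ` has logarithmic density `d`:
`(1 / log r) ∫_{E ∩ [1, r]} dt / t → d` as `r → ∞`. -/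
def HasLogDensity (E : Set ℝ) (d : ℝ) : Prop :=
  MeasurableSet E ∧
    Tendsto (fun r : ℝ => (∫ t in E ∩ Set.Icc 1 r, t⁻¹) / Real.log r) atTop (𝓝 d)

end

/-! On a circle `‖z‖ = t`, `log ‖f‖` stays close in L¹ mean to a number `ℓ(t) = c + ∑ D(a) log
max(t, ‖a‖)`, where `D` is the divisor of `f` in a disc of radius `R = K s`, with `s` bounding the
radii `t` in question. Dividing out zeros and poles leaves a harmonic function, whose oscillation
carries a factor `O(1/K)`; each factor `z - a` contributes `O(1)` uniformly in `a`. The error is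
thus `O(T(R)/K) + O(n(R))` up to bounded terms, and `n(R) log M` is at most about `2 T(M R)`. Since
`|ℓ(‖p‖ r) - ℓ(r)| ≤ n(R) |log ‖p‖|`, the proximity of `f(p z) / f(z)` is at most `ε T(c r)` for
large `K`, `M` and a constant `c` depending on `ε` and `p` (`proximity_comp_mul_div_le`).

Order zero gives `T(c r) ≤ 2 T(r)` on a set of logarithmic density 1 for each fixed `c`. As `c`
grows when `ε → 0`, these sets are diagonalised into one `E`. `IsNegligible` records estimates
before this last step, so that finitely many combine.

For higher `k`, induction bounds `D_q^k f(p z) / f(z)` for every `p ≠ 0` at once. The denominator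
stays `f`, so the growth of `D_q^k f` is never needed. -/

/-! ### Sets of logarithmic density 1 -/

theorem integrableOn_inv_of_subset_Icc {s : Set ℝ} {r : ℝ} (hs : s ⊆ Set.Icc 1 r) :
    IntegrableOn (fun t : ℝ => t⁻¹) s := by
  refine IntegrableOn.mono_set (ContinuousOn.integrableOn_Icc ?_) hs
  exact continuousOn_inv₀.mono fun t ht => (zero_lt_one.trans_le ht.1).ne'

theorem setIntegral_Icc_inv {r : ℝ} (hr : 1 ≤ r) : ∫ t in Set.Icc 1 r, t⁻¹ = Real.log r := by
  rw [integral_Icc_eq_integral_Ioc, ← intervalIntegral.integral_of_le hr,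
    integral_inv_of_pos one_pos (by linarith), div_one]

theorem setIntegral_inv_mono {s t : Set ℝ} {r : ℝ} (hst : s ⊆ t) (ht : t ⊆ Set.Icc 1 r)
    (hm : MeasurableSet t) : ∫ x in s, x⁻¹ ≤ ∫ x in t, x⁻¹ := by
  refine setIntegral_mono_set (integrableOn_inv_of_subset_Icc ht) ?_ hst.eventuallyLE
  filter_upwards [ae_restrict_mem hm] with x hx
  exact inv_nonneg.2 (zero_le_one.trans (ht hx).1)

/-- A set whose logarithmic density is at least `1` has logarithmic density `1`. -/
theorem hasLogDensity_one_of_le {E : Set ℝ} (hE : MeasurableSet E)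
    (h : ∀ ε > 0, ∀ᶠ r in atTop, (1 - ε) * Real.log r ≤ ∫ t in E ∩ Set.Icc 1 r, t⁻¹) :
    HasLogDensity E 1 := by
  refine ⟨hE, ?_⟩
  rw [Metric.tendsto_nhds]
  intro ε hε
  filter_upwards [h (ε / 2) (half_pos hε), eventually_gt_atTop 1] with r hr h1
  have hl := Real.log_pos h1
  have hup : ∫ t in E ∩ Set.Icc 1 r, t⁻¹ ≤ Real.log r := by
    rw [← setIntegral_Icc_inv h1.le]
    exact setIntegral_inv_mono Set.inter_subset_right subset_rfl measurableSet_Icc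
  have h2 : (∫ t in E ∩ Set.Icc 1 r, t⁻¹) / Real.log r ≤ 1 := (div_le_one hl).2 hup
  have h3 : 1 - ε / 2 ≤ (∫ t in E ∩ Set.Icc 1 r, t⁻¹) / Real.log r := (le_div_iff₀ hl).2 hr
  rw [Real.dist_eq, abs_lt]
  constructor <;> linarith

/-- A slowly growing monotone function satisfies a doubling condition on a set of logarithmic
density `1`. -/
theorem hasLogDensity_setOf_le_two_mul {T : ℝ → ℝ} (hT : Monotone T) (h1 : ∀ r, 1 ≤ T r)
    (horder : ∀ ε > 0, ∀ᶠ r in atTop, Real.log (T r) ≤ ε * Real.log r) {c : ℝ} (hc : 1 < c) :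
    HasLogDensity {r | T (c * r) ≤ 2 * T r} 1 := by
  have hc0 : 0 < c := by linarith
  have hmc : Measurable fun r => T (c * r) := hT.measurable.comp (measurable_const_mul c)
  have hm : MeasurableSet {r | T (c * r) ≤ 2 * T r} :=
    measurableSet_le hmc (hT.measurable.const_mul 2)
  refine hasLogDensity_one_of_le hm fun ε hε => ?_
  set u : ℝ → ℝ := fun r => Real.log (T r) with hu_def
  have hu : Monotone u := fun a b hab =>
    Real.log_le_log (zero_lt_one.trans_le (h1 a)) (hT hab)
  have hu0 : ∀ r, 0 ≤ u r := fun r => Real.log_nonneg (h1 r)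
  have hl2 : 0 < Real.log 2 := Real.log_pos one_lt_two
  have hlc : 0 < Real.log c := Real.log_pos hc
  have hint : ∀ a b, 0 < a → 0 < b → IntervalIntegrable (fun t => u t * t⁻¹) volume a b := by
    intro a b ha hb
    refine (hu.intervalIntegrable (a := a) (b := b)).mul_continuousOn ?_
    exact continuousOn_inv₀.mono fun t ht => (lt_of_lt_of_le (lt_min ha hb) ht.1).ne'
  -- The integral of `(u(ct) - u(t)) / t` over `[1, r]` telescopes to one over `[r, cr]` minus one
  -- over `[1, c]`, while off the doubling set its integrand exceeds `log 2 / t`.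
  have key : ∀ r, 1 ≤ r →
      Real.log 2 * ∫ t in {r | T (c * r) ≤ 2 * T r}ᶜ ∩ Set.Icc 1 r, t⁻¹
        ≤ u (c * r) * Real.log c := by
    intro r hr
    have hr0 : 0 < r := by linarith
    have hsub : ∫ t in (1 : ℝ)..r, u (c * t) * t⁻¹ = ∫ t in c..(c * r), u t * t⁻¹ := by
      have := intervalIntegral.integral_comp_mul_left (a := 1) (b := r)
        (fun t => u t * t⁻¹) hc0.ne'
      rw [mul_one] at this
      rw [← smul_right_injective ℝ (inv_ne_zero hc0.ne') |>.eq_iff, ← this, smul_eq_mul,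
        ← intervalIntegral.integral_const_mul]
      refine intervalIntegral.integral_congr fun t _ => ?_
      simp only [mul_inv]
      ring
    have hintc : IntervalIntegrable (fun t => u (c * t) * t⁻¹) volume 1 r := by
      have hmono : Monotone fun t => u (c * t) := fun a b hab =>
        hu (mul_le_mul_of_nonneg_left hab hc0.le)
      refine (hmono.intervalIntegrable (a := 1) (b := r)).mul_continuousOn ?_
      exact continuousOn_inv₀.mono fun t ht => (lt_of_lt_of_le (lt_min one_pos hr0) ht.1).ne'
    have hdiff : ∫ t in (1 : ℝ)..r, (u (c * t) - u t) * t⁻¹ ≤ u (c * r) * Real.log c := by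
      have e1 : ∫ t in (1 : ℝ)..r, (u (c * t) - u t) * t⁻¹
          = (∫ t in r..(c * r), u t * t⁻¹) - ∫ t in (1 : ℝ)..c, u t * t⁻¹ := by
        simp_rw [sub_mul]
        rw [intervalIntegral.integral_sub hintc (hint 1 r one_pos hr0), hsub]
        have a1 := intervalIntegral.integral_add_adjacent_intervals (hint 1 c one_pos hc0)
          (hint c (c * r) hc0 (by positivity))
        have a2 := intervalIntegral.integral_add_adjacent_intervals (hint 1 r one_pos hr0)
          (hint r (c * r) hr0 (by positivity))
        linarith
      have e2 : 0 ≤ ∫ t in (1 : ℝ)..c, u t * t⁻¹ :=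
        intervalIntegral.integral_nonneg hc.le fun t ht =>
          mul_nonneg (hu0 t) (inv_nonneg.2 (by linarith [ht.1]))
      have hrc : r ≤ c * r := le_mul_of_one_le_left hr0.le hc.le
      have e3 : ∫ t in r..(c * r), u t * t⁻¹ ≤ ∫ t in r..(c * r), u (c * r) * t⁻¹ := by
        refine intervalIntegral.integral_mono_on hrc (hint r _ hr0 (by positivity)) ?_ ?_
        · refine IntervalIntegrable.const_mul ?_ _
          exact intervalIntegral.intervalIntegrable_inv (fun t ht => by
            rw [Set.uIcc_of_le hrc] at ht; exact (hr0.trans_le ht.1).ne') continuousOn_id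
        · intro t ht
          exact mul_le_mul_of_nonneg_right (hu ht.2) (inv_nonneg.2 (hr0.le.trans ht.1))
      rw [intervalIntegral.integral_const_mul, integral_inv_of_pos hr0 (by positivity),
        mul_div_assoc, div_self hr0.ne', mul_one] at e3
      linarith
    refine le_trans ?_ hdiff
    rw [intervalIntegral.integral_of_le hr, ← integral_Icc_eq_integral_Ioc,
      ← integral_const_mul]
    have hintI : IntegrableOn (fun t => (u (c * t) - u t) * t⁻¹) (Set.Icc 1 r) := by
      simp_rw [sub_mul]
      exact (intervalIntegrable_iff_integrableOn_Icc_of_le hr).1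
        (hintc.sub (hint 1 r one_pos hr0))
    calc ∫ t in {r | T (c * r) ≤ 2 * T r}ᶜ ∩ Set.Icc 1 r, Real.log 2 * t⁻¹
        ≤ ∫ t in {r | T (c * r) ≤ 2 * T r}ᶜ ∩ Set.Icc 1 r, (u (c * t) - u t) * t⁻¹ := by
          refine setIntegral_mono_on
            ((integrableOn_inv_of_subset_Icc Set.inter_subset_right).const_mul _)
            (hintI.mono_set Set.inter_subset_right) (hm.compl.inter measurableSet_Icc) ?_
          intro t ht
          refine mul_le_mul_of_nonneg_right ?_ (inv_nonneg.2 (zero_le_one.trans ht.2.1))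
          have ht1 : 2 * T t < T (c * t) := not_le.1 ht.1
          have hT0 : 0 < T t := zero_lt_one.trans_le (h1 t)
          have := Real.log_le_log (by positivity) ht1.le
          rw [Real.log_mul two_ne_zero hT0.ne'] at this
          simp only [hu_def]
          linarith
      _ ≤ ∫ t in Set.Icc 1 r, (u (c * t) - u t) * t⁻¹ := by
          refine setIntegral_mono_set hintI ?_ Set.inter_subset_right.eventuallyLE
          filter_upwards [ae_restrict_mem measurableSet_Icc] with t ht
          have ht0 : 0 ≤ t := zero_le_one.trans ht.1
          exact mul_nonneg (sub_nonneg.2 (hu (le_mul_of_one_le_left ht0 hc.le)))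
            (inv_nonneg.2 ht0)
  -- Solves `δ * (2 log r) * log c = log 2 * (ε log r)`; the 2 comes from `log (c r) ≤ 2 log r` for
  -- `r ≥ c`.
  set δ : ℝ := ε * Real.log 2 / (2 * Real.log c) with hδ_def
  have hδ : 0 < δ := by positivity
  have hcr : Tendsto (fun r : ℝ => c * r) atTop atTop := tendsto_id.const_mul_atTop hc0
  filter_upwards [hcr.eventually (horder δ hδ), eventually_ge_atTop 1, eventually_ge_atTop c]
    with r h2 hr hrc
  have hr0 : 0 < r := by linarith
  have hk := key r hr
  have hlog : Real.log (c * r) ≤ 2 * Real.log r := by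
    rw [Real.log_mul hc0.ne' hr0.ne']
    linarith [Real.log_le_log hc0 hrc]
  have hsplit : Real.log r = (∫ t in {r | T (c * r) ≤ 2 * T r} ∩ Set.Icc 1 r, t⁻¹)
      + ∫ t in {r | T (c * r) ≤ 2 * T r}ᶜ ∩ Set.Icc 1 r, t⁻¹ := by
    rw [← setIntegral_Icc_inv hr, Set.inter_comm, Set.inter_comm _ᶜ, ← Set.sdiff_eq]
    exact (integral_inter_add_sdiff hm (integrableOn_inv_of_subset_Icc subset_rfl)).symm
  have hB : Real.log 2 * ∫ t in {r | T (c * r) ≤ 2 * T r}ᶜ ∩ Set.Icc 1 r, t⁻¹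
      ≤ Real.log 2 * (ε * Real.log r) :=
    calc _ ≤ u (c * r) * Real.log c := hk
      _ ≤ δ * (2 * Real.log r) * Real.log c :=
          mul_le_mul_of_nonneg_right (h2.trans (mul_le_mul_of_nonneg_left hlog hδ.le)) hlc.le
      _ = Real.log 2 * (ε * Real.log r) := by rw [hδ_def]; field_simp
  have := le_of_mul_le_mul_left hB hl2
  linarith

/-- A decreasing sequence of sets of logarithmic density `1` has a pseudo-intersection of
logarithmic density `1`. -/
theorem exists_hasLogDensity_one_forall_eventually {G : ℕ → Set ℝ} (hG : Antitone G)
    (hd : ∀ n, HasLogDensity (G n) 1) :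
    ∃ E : Set ℝ, HasLogDensity E 1 ∧ ∀ n, ∀ᶠ r in atTop, r ∈ E → r ∈ G n := by
  have hex : ∀ n : ℕ, ∃ a : ℝ, 1 ≤ a ∧ ∀ r ≥ a,
      (1 - 1 / ((n : ℝ) + 1)) * Real.log r ≤ ∫ t in G n ∩ Set.Icc 1 r, t⁻¹ := by
    intro n
    have hlt : 1 - 1 / ((n : ℝ) + 1) < 1 := by
      have : 0 < 1 / ((n : ℝ) + 1) := by positivity
      linarith
    have h := ((hd n).2.eventually (lt_mem_nhds hlt)).and (eventually_gt_atTop 1)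
    obtain ⟨a, ha⟩ := eventually_atTop.1 h
    refine ⟨max a 1, le_max_right _ _, fun r hr => ?_⟩
    obtain ⟨h1, h2⟩ := ha r (le_of_max_le_left hr)
    exact ((lt_div_iff₀ (Real.log_pos h2)).1 h1).le
  choose a ha1 ha using hex
  -- Monotone thresholds dominating both `a n` and `n`.
  set b : ℕ → ℝ := fun n => (∑ i ∈ Finset.range (n + 1), a i) + n with hb_def
  have hab : ∀ n, a n ≤ b n := by
    intro n
    have : a n ≤ ∑ i ∈ Finset.range (n + 1), a i :=
      Finset.single_le_sum (f := a) (fun i _ => zero_le_one.trans (ha1 i)) (by simp)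
    have hn : (0 : ℝ) ≤ n := n.cast_nonneg
    simp only [hb_def]
    linarith
  have hbn : ∀ n : ℕ, (n : ℝ) ≤ b n := by
    intro n
    have : 0 ≤ ∑ i ∈ Finset.range (n + 1), a i :=
      Finset.sum_nonneg fun i _ => zero_le_one.trans (ha1 i)
    simp only [hb_def]
    linarith
  have hbmono : Monotone b := by
    refine monotone_nat_of_le_succ fun n => ?_
    simp only [hb_def]
    rw [Finset.sum_range_succ _ (n + 1)]
    push_cast
    linarith [ha1 (n + 1)]
  -- `G n` is imposed only from `b n` on. For `b n ≤ r < b (n + 1)`, the later conditions are void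
  -- on `[1, r]` and the earlier ones follow from `G n`, so `E` contains `G n` there.
  set E : Set ℝ := ⋂ n, (G n ∪ Set.Iio (b n)) with hE_def
  have hEm : MeasurableSet E :=
    MeasurableSet.iInter fun n => (hd n).1.union measurableSet_Iio
  refine ⟨E, hasLogDensity_one_of_le hEm fun ε hε => ?_, fun n => ?_⟩
  · obtain ⟨m, hm⟩ := exists_nat_one_div_lt hε
    filter_upwards [eventually_ge_atTop (b m), eventually_ge_atTop 1] with r hr h1
    classical
    have hfin : ∃ n, r < b (n + 1) := by
      obtain ⟨n, hn⟩ := exists_nat_gt r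
      exact ⟨n, hn.trans_le ((hbn n).trans (hbmono n.le_succ))⟩
    set n := Nat.find hfin
    have hn : r < b (n + 1) := Nat.find_spec hfin
    have hmn : m ≤ n := by
      by_contra hlt
      exact absurd (hn.trans_le (hbmono (Nat.succ_le_of_lt (not_le.1 hlt)))) (not_lt.2 hr)
    have hbr : b n ≤ r := by
      rcases Nat.eq_zero_or_pos n with h0 | hpos
      · rw [h0]; exact (hbmono (Nat.zero_le m)).trans hr
      · have := Nat.find_min hfin (m := n - 1) (by omega)
        rwa [not_lt, Nat.sub_add_cancel hpos] at this
    have hsub : G n ∩ Set.Icc 1 r ⊆ E ∩ Set.Icc 1 r := by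
      refine fun t ht => ⟨Set.mem_iInter.2 fun j => ?_, ht.2⟩
      rcases le_or_gt j n with hj | hj
      · exact Or.inl (hG hj ht.1)
      · exact Or.inr (ht.2.2.trans_lt (hn.trans_le (hbmono hj)))
    refine le_trans ?_ (setIntegral_inv_mono hsub Set.inter_subset_right
      (hEm.inter measurableSet_Icc))
    refine le_trans (mul_le_mul_of_nonneg_right ?_ (Real.log_nonneg h1)) (ha n r ((hab n).trans hbr))
    have : 1 / ((n : ℝ) + 1) ≤ 1 / ((m : ℝ) + 1) := by gcongr
    linarith
  · filter_upwards [eventually_ge_atTop (b n)] with r hr hrE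
    exact (Set.mem_iInter.1 hrE n).resolve_right (not_lt.2 hr)

/-! ### Mean oscillation of `log ‖z - a‖` and of harmonic functions -/

open Real Metric in
-- The left side is Jensen's value for the circle mean of `log ‖z - a‖`, with `x = ‖a‖`.
theorem log_add_posLog_eq_log_max {r x : ℝ} (hr : 0 < r) (hx : 0 ≤ x) :
    log r + log⁺ (r⁻¹ * x) = log (max r x) := by
  rcases le_total x r with h | h
  · have : r⁻¹ * x ≤ 1 := by rw [inv_mul_le_iff₀ hr]; simpa
    rw [max_eq_left h, posLog_eq_zero_iff _ |>.2 (by rwa [abs_of_nonneg (by positivity)]), add_zero]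
  · have h1 : 1 ≤ r⁻¹ * x := by rw [le_inv_mul_iff₀ hr]; simpa
    have hx0 : 0 < x := hr.trans_le h
    rw [max_eq_right h, posLog_eq_log (by rwa [abs_of_nonneg (by positivity)]),
      log_mul (inv_ne_zero hr.ne') hx0.ne', log_inv]
    ring

open Real in
-- For `r ≤ s` one has `max s x / max r x ≤ s / r`. Changing the radius therefore costs an amount
-- independent of the zero or pole.
theorem abs_log_max_sub_log_max_le {r s x : ℝ} (hr : 0 < r) (hs : 0 < s) :
    |log (max r x) - log (max s x)| ≤ |log r - log s| := by
  rcases le_total r s with h | h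
  · have h1 : max r x ≤ max s x := max_le_max_right x h
    have h0 : 0 < max r x := hr.trans_le (le_max_left _ _)
    have h2 := log_le_log h0 h1
    have h3 := log_le_log hr h
    rw [abs_of_nonpos (by linarith), abs_of_nonpos (by linarith)]
    have : log (s / r) ≥ log (max s x / max r x) := by
      refine log_le_log (div_pos (hs.trans_le (le_max_left _ _)) h0) ?_
      rw [div_le_div_iff₀ h0 hr]
      rcases le_total s x with hx | hx
      · rw [max_eq_right hx, max_eq_right (h.trans hx), mul_comm]; gcongr; linarith
      · rw [max_eq_left hx]; gcongr; exact le_max_left _ _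
    rw [log_div hs.ne' hr.ne', log_div (h0.trans_le h1).ne' h0.ne'] at this
    linarith
  · have h1 : max s x ≤ max r x := max_le_max_right x h
    have h0 : 0 < max s x := hs.trans_le (le_max_left _ _)
    have h2 := log_le_log h0 h1
    have h3 := log_le_log hs h
    rw [abs_of_nonneg (by linarith), abs_of_nonneg (by linarith)]
    have : log (r / s) ≥ log (max r x / max s x) := by
      refine log_le_log (div_pos (hr.trans_le (le_max_left _ _)) h0) ?_
      rw [div_le_div_iff₀ h0 hs]
      rcases le_total r x with hx | hx
      · rw [max_eq_right hx, max_eq_right (h.trans hx), mul_comm]; gcongr; linarith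
      · rw [max_eq_left hx]; gcongr; exact le_max_left _ _
    rw [log_div hr.ne' hs.ne', log_div (h0.trans_le h1).ne' h0.ne'] at this
    linarith

/-- The mean oscillation of `log ‖z - a‖` on a circle is bounded, uniformly in `a`. -/
theorem circleAverage_abs_log_norm_sub_sub_log_max_le {r : ℝ} (hr : 1 ≤ r) (a : ℂ) :
    Real.circleAverage (fun z => |Real.log ‖z - a‖ - Real.log (max r ‖a‖)|) 0 r
      ≤ 2 * Real.log 2 := by
  have hr0 : 0 < r := by linarith
  set c := Real.log (max r ‖a‖) with hc_def
  have hint : CircleIntegrable (fun z => Real.log ‖z - a‖ - c) 0 r :=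
    (circleIntegrable_log_norm_sub_const r).sub (circleIntegrable_const c 0 r)
  -- If `x ≤ log 2` then `|x| ≤ 2 log 2 - x`, and here `x` has mean zero by Jensen. The bound `r ≥
  -- 1` covers the value `log 0 = 0` at `z = a`.
  have hle : ∀ z ∈ Metric.sphere (0 : ℂ) |r|,
      |Real.log ‖z - a‖ - c| ≤ 2 * Real.log 2 - (Real.log ‖z - a‖ - c) := by
    intro z hz
    have hz' : ‖z‖ = r := by simpa [abs_of_pos hr0] using hz
    have hmax : 1 ≤ max r ‖a‖ := hr.trans (le_max_left _ _)
    have hu : Real.log ‖z - a‖ ≤ Real.log 2 + c := by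
      rw [hc_def, ← Real.log_mul two_ne_zero (by positivity)]
      rcases eq_or_ne (z - a) 0 with h0 | h0
      · rw [h0, norm_zero, Real.log_zero]
        exact Real.log_nonneg (by linarith)
      · refine Real.log_le_log (norm_pos_iff.2 h0) ((norm_sub_le _ _).trans ?_)
        rw [hz', two_mul]
        exact add_le_add (le_max_left _ _) (le_max_right _ _)
    have hl2 : 0 < Real.log 2 := Real.log_pos one_lt_two
    rw [abs_le]
    constructor <;> linarith
  have havg : Real.circleAverage (fun z => Real.log ‖z - a‖ - c) 0 r = 0 := by
    have h1 : Real.circleAverage (fun z => Real.log ‖z - a‖ - c) 0 r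
        = Real.circleAverage (fun z => Real.log ‖z - a‖) 0 r - c := by
      rw [Real.circleAverage_fun_sub (circleIntegrable_log_norm_sub_const r)
        (circleIntegrable_const c 0 r), Real.circleAverage_const]
    rw [h1, circleAverage_log_norm_sub_const_eq_log_radius_add_posLog hr0.ne', zero_sub, norm_neg,
      log_add_posLog_eq_log_max hr0 (norm_nonneg a), sub_self]
  calc _ ≤ Real.circleAverage (fun z => 2 * Real.log 2 - (Real.log ‖z - a‖ - c)) 0 r :=
        Real.circleAverage_mono hint.abs ((circleIntegrable_const _ 0 r).sub hint) hle
    _ = 2 * Real.log 2 := by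
        rw [Real.circleAverage_fun_sub (circleIntegrable_const _ 0 r) hint, havg,
          Real.circleAverage_const, sub_zero]

/-- Oscillation of a harmonic function near the centre of a disc, bounded by its mean on the
boundary circle. -/
theorem abs_sub_le_mul_circleAverage_abs_of_harmonicOnNhd {h : ℂ → ℝ} {R : ℝ}
    (hh : InnerProductSpace.HarmonicOnNhd h (Metric.closedBall 0 R)) (κ : ℝ) {w : ℂ}
    (hw : ‖w‖ < R) :
    |h w - h 0| ≤ 2 * ‖w‖ / (R - ‖w‖) * Real.circleAverage (fun z => |h z - κ|) 0 R := by
  have hR : 0 < R := (norm_nonneg w).trans_lt hw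
  have hk : InnerProductSpace.HarmonicOnNhd (fun z => h z - κ) (Metric.closedBall 0 R) :=
    fun x hx => (hh x hx).sub (InnerProductSpace.harmonicAt_const κ)
  have hcont : ContinuousOn h (Metric.sphere 0 |R|) := fun x hx =>
    ((hh x (by rw [abs_of_pos hR] at hx; exact Metric.sphere_subset_closedBall hx)).1.continuousAt
      ).continuousWithinAt
  have hki : CircleIntegrable (fun z => h z - κ) 0 R :=
    (hcont.sub continuousOn_const).circleIntegrable'
  have hwb : w ∈ Metric.ball (0 : ℂ) R := by simpa using hw
  have hPc : ContinuousOn (poissonKernel 0 w) (Metric.sphere 0 |R|) := by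
    intro z hz
    have hz' : ‖z‖ = R := by simpa [abs_of_pos hR] using hz
    have hne : z - w ≠ 0 := by
      intro h0
      rw [sub_eq_zero.1 h0] at hz'
      linarith
    have hne' : ‖z - w‖ ^ 2 ≠ 0 := by positivity
    refine ContinuousAt.continuousWithinAt ?_
    have : poissonKernel 0 w = fun z => (‖z‖ ^ 2 - ‖w‖ ^ 2) / ‖z - w‖ ^ 2 := by
      ext z; simp [poissonKernel_def]
    rw [this]
    fun_prop (disch := assumption)
  have hPi : CircleIntegrable (poissonKernel 0 w • fun z => h z - κ) 0 R :=
    (hPc.smul (hcont.sub continuousOn_const)).circleIntegrable'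
  have e1 := hk.circleAverage_poissonKernel_smul hwb
  have e0 : Real.circleAverage (fun z => h z - κ) 0 R = h 0 - κ :=
    InnerProductSpace.HarmonicOnNhd.circleAverage_eq (by rwa [abs_of_pos hR])
  -- Since the Poisson kernel has mean 1, the increment is the mean of `(P - 1)(h - κ)` for any `κ`,
  -- and `P - 1 = Re (2w / (z - w))`.
  have e2 : h w - h 0
      = Real.circleAverage ((poissonKernel 0 w • fun z => h z - κ) - fun z => h z - κ) 0 R := by
    rw [Real.circleAverage_sub hPi hki, e1, e0]; ring
  rw [e2]
  refine Real.abs_circleAverage_le_circleAverage_abs.trans ?_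
  rw [← smul_eq_mul, ← Real.circleAverage_fun_smul]
  refine Real.circleAverage_mono (hPi.sub hki).abs ?_ ?_
  · exact hki.abs.const_smul
  · intro z hz
    have hz' : ‖z‖ = R := by simpa [abs_of_pos hR] using hz
    have hne : z - w ≠ 0 := by
      intro h0
      rw [sub_eq_zero.1 h0] at hz'
      linarith
    have hlow : R - ‖w‖ ≤ ‖z - w‖ := by rw [← hz']; exact norm_sub_norm_le z w
    have hP : |poissonKernel 0 w z - 1| ≤ 2 * ‖w‖ / (R - ‖w‖) := by
      have : poissonKernel 0 w z - 1 = (2 * w / (z - w)).re := by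
        rw [poissonKernel_eq_re_herglotzRieszKernel, Function.comp_apply, herglotzRieszKernel_def,
          ← Complex.one_re, ← Complex.sub_re]
        congr 1
        simp only [sub_zero]
        field_simp
        ring
      rw [this]
      refine (Complex.abs_re_le_norm _).trans ?_
      rw [norm_div, norm_mul, Complex.norm_two]
      have : 0 < R - ‖w‖ := by linarith
      gcongr
    have : ((poissonKernel 0 w • fun z => h z - κ) - fun z => h z - κ) z
        = (poissonKernel 0 w z - 1) * (h z - κ) := by
      change poissonKernel 0 w z * (h z - κ) - (h z - κ) = _
      ring
    rw [Pi.abs_apply, this, abs_mul, smul_eq_mul]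
    exact mul_le_mul_of_nonneg_right hP (abs_nonneg _)

/-- Rotating by `arg p` preserves the mean, so only the scaling of the radius remains. -/
theorem circleAverage_comp_mul_left {E : Type*} [NormedAddCommGroup E] [NormedSpace ℝ E]
    (f : ℂ → E) (p : ℂ) (r : ℝ) :
    Real.circleAverage (fun z => f (p * z)) 0 r = Real.circleAverage f 0 (‖p‖ * r) := by
  rw [Real.circleAverage_eq_integral_add (f := f) p.arg, Real.circleAverage_def]
  congr 2
  ext θ
  congr 1
  simp only [circleMap, zero_add, Complex.ofReal_mul, Complex.ofReal_add, add_mul, Complex.exp_add]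
  nth_rw 1 [← Complex.norm_mul_exp_arg_mul_I p]
  ring

/-! ### Mean oscillation of `log ‖f‖` and the quotient `f(p z) / f(z)` -/

/-- The mean oscillation of `log ‖f‖` on circles inside a disc, for `f` meromorphic, in terms of
the divisor and of the boundary values. -/
theorem exists_circleAverage_abs_log_norm_sub_le {f : ℂ → ℂ} (hf : Meromorphic f)
    (hord : ∀ z, meromorphicOrderAt f z ≠ ⊤) {R : ℝ} (hR : 1 ≤ R) {S : Finset ℂ}
    (hS : Function.support (MeromorphicOn.divisor f (Metric.closedBall 0 R)) ⊆ S)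
    (hSR : ∀ a ∈ S, ‖a‖ ≤ R) :
    ∃ c : ℝ, ∀ r, 1 ≤ r → r < R →
      Real.circleAverage (fun z => |Real.log ‖f z‖ - (c + ∑ a ∈ S,
          MeromorphicOn.divisor f (Metric.closedBall 0 R) a * Real.log (max r ‖a‖))|) 0 r
        ≤ 2 * r / (R - r) * (Real.circleAverage (fun z => |Real.log ‖f z‖|) 0 R
            + 2 * Real.log 2 * ∑ a ∈ S, |(MeromorphicOn.divisor f (Metric.closedBall 0 R) a : ℝ)|)
          + 2 * Real.log 2 *
            ∑ a ∈ S, |(MeromorphicOn.divisor f (Metric.closedBall 0 R) a : ℝ)| := by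
  have hR0 : 0 < R := by linarith
  set D := MeromorphicOn.divisor f (Metric.closedBall 0 R) with hD_def
  set n : ℝ := ∑ a ∈ S, |(D a : ℝ)| with hn_def
  obtain ⟨g, hg, hg0, hfg⟩ := MeromorphicOn.extract_zeros_poles
    (hf.meromorphicOn (s := Metric.closedBall 0 R)) (fun u => hord u)
    (D.finiteSupport (isCompact_closedBall 0 R))
  have hlog := MeromorphicOn.extract_zeros_poles_log hg0 hfg
  rw [← hD_def] at hlog
  have hsum : (∑ᶠ u, fun z : ℂ => (D u : ℝ) * Real.log ‖z - u‖)
      = ∑ u ∈ S, fun z : ℂ => (D u : ℝ) * Real.log ‖z - u‖ := by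
    refine finsum_eq_sum_of_support_subset _ fun u hu => hS ?_
    rw [Function.mem_support] at hu ⊢
    contrapose! hu
    ext z
    simp [hu]
  have hlog' : (fun z => Real.log ‖f z‖) =ᶠ[codiscreteWithin (Metric.closedBall 0 R)]
      fun z => (∑ u ∈ S, (D u : ℝ) * Real.log ‖z - u‖) + Real.log ‖g z‖ := by
    filter_upwards [hlog] with z hz
    rw [hz, hsum]
    simp
  have hharm : InnerProductSpace.HarmonicOnNhd (fun z => Real.log ‖g z‖) (Metric.closedBall 0 R) :=
    fun x hx => (hg x hx).harmonicAt_log_norm (hg0 ⟨x, hx⟩)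
  have hcg : ∀ r, 0 ≤ r → r ≤ R → CircleIntegrable (fun z => Real.log ‖g z‖) 0 r := by
    intro r hr hrR
    refine MeromorphicOn.circleIntegrable_log_norm_of_nonneg (fun x hx => (hg x ?_).meromorphicAt) hr
    exact Metric.closedBall_subset_closedBall hrR (Metric.sphere_subset_closedBall hx)
  have hcf : ∀ r, CircleIntegrable (fun z => Real.log ‖f z‖) 0 r := fun r =>
    hf.meromorphicOn.circleIntegrable_log_norm
  have hca : ∀ r (a : ℂ), CircleIntegrable
      (fun z => |(D a : ℝ)| * |Real.log ‖z - a‖ - Real.log (max r ‖a‖)|) 0 r := fun r a =>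
    (((circleIntegrable_log_norm_sub_const r).sub
      (circleIntegrable_const (Real.log (max r ‖a‖)) 0 r)).abs).const_smul (a := |(D a : ℝ)|)
  have havg : ∀ r, 1 ≤ r → Real.circleAverage
      (fun z => ∑ a ∈ S, |(D a : ℝ)| * |Real.log ‖z - a‖ - Real.log (max r ‖a‖)|) 0 r
        ≤ 2 * Real.log 2 * n := by
    intro r hr
    rw [Real.circleAverage_fun_sum fun a _ => hca r a, hn_def, Finset.mul_sum]
    refine Finset.sum_le_sum fun a _ => ?_
    simp_rw [← smul_eq_mul |(D a : ℝ)|]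
    rw [Real.circleAverage_fun_smul, smul_eq_mul, mul_comm]
    exact mul_le_mul_of_nonneg_right (circleAverage_abs_log_norm_sub_sub_log_max_le hr a)
      (abs_nonneg _)
  have hcodisc : ∀ r, 0 ≤ r → r ≤ R →
      codiscreteWithin (Metric.sphere (0 : ℂ) |r|) ≤ codiscreteWithin (Metric.closedBall 0 R) := by
    intro r hr hrR
    rw [abs_of_nonneg hr]
    exact codiscreteWithin_mono
      (Metric.sphere_subset_closedBall.trans (Metric.closedBall_subset_closedBall hrR))
  -- On `‖z‖ = R`, `log ‖g‖ - κ` is `log ‖f‖` minus the sum of the centred terms `D(a) (log ‖z - a‖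
  -- - log R)`, as all `‖a‖ ≤ R`.
  set κ : ℝ := -∑ a ∈ S, (D a : ℝ) * Real.log R with hκ_def
  have hbdry : Real.circleAverage (fun z => |Real.log ‖g z‖ - κ|) 0 R
      ≤ Real.circleAverage (fun z => |Real.log ‖f z‖|) 0 R + 2 * Real.log 2 * n := by
    have hcongr : Real.circleAverage (fun z => |Real.log ‖g z‖ - κ|) 0 R
        = Real.circleAverage (fun z => |Real.log ‖f z‖ -
            ∑ a ∈ S, (D a : ℝ) * (Real.log ‖z - a‖ - Real.log (max R ‖a‖))|) 0 R := by
      refine Real.circleAverage_congr_codiscreteWithin ?_ hR0.ne'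
      filter_upwards [hcodisc R hR0.le le_rfl hlog'] with z hz
      have : ∑ a ∈ S, (D a : ℝ) * (Real.log ‖z - a‖ - Real.log (max R ‖a‖))
          = (∑ a ∈ S, (D a : ℝ) * Real.log ‖z - a‖) + κ := by
        rw [hκ_def, ← Finset.sum_neg_distrib, ← Finset.sum_add_distrib]
        refine Finset.sum_congr rfl fun a ha => ?_
        rw [max_eq_left (hSR a ha)]; ring
      rw [hz, this]
      congr 1
      ring
    rw [hcongr]
    refine le_trans ?_ (add_le_add_right (havg R hR) _)
    rw [← Real.circleAverage_fun_add (f₁ := fun z => |Real.log ‖f z‖|) (hcf R).abs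
      (CircleIntegrable.fun_sum S fun a _ => hca R a)]
    refine Real.circleAverage_mono ?_
      ((hcf R).abs.add (CircleIntegrable.fun_sum S fun a _ => hca R a)) ?_
    · refine ((hcf R).sub (CircleIntegrable.fun_sum S fun a _ => ?_)).abs
      exact ((circleIntegrable_log_norm_sub_const R).sub
        (circleIntegrable_const (Real.log (max R ‖a‖)) 0 R)).const_smul (a := (D a : ℝ))
    · intro z _
      refine (abs_sub _ _).trans (add_le_add_right ((Finset.abs_sum_le_sum_abs _ _).trans ?_) _)
      exact Finset.sum_le_sum fun a _ => (abs_mul _ _).le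
  -- This constant does not depend on `r`, so it cancels when two radii are compared.
  refine ⟨Real.log ‖g 0‖, fun r hr hrR => ?_⟩
  have hr0 : 0 < r := by linarith
  set M : ℝ := 2 * r / (R - r) * (Real.circleAverage (fun z => |Real.log ‖f z‖|) 0 R
    + 2 * Real.log 2 * n)
  have hcongr : Real.circleAverage (fun z => |Real.log ‖f z‖ - (Real.log ‖g 0‖ + ∑ a ∈ S,
        (D a : ℝ) * Real.log (max r ‖a‖))|) 0 r
      = Real.circleAverage (fun z => |(Real.log ‖g z‖ - Real.log ‖g 0‖) +
            ∑ a ∈ S, (D a : ℝ) * (Real.log ‖z - a‖ - Real.log (max r ‖a‖))|) 0 r := by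
    refine Real.circleAverage_congr_codiscreteWithin ?_ hr0.ne'
    filter_upwards [hcodisc r hr0.le hrR.le hlog'] with z hz
    simp_rw [mul_sub]
    rw [hz, Finset.sum_sub_distrib]
    congr 1
    ring
  rw [hcongr]
  refine le_trans ?_ (add_le_add_right (havg r hr) _)
  rw [← Real.circleAverage_const M 0 r, ← Real.circleAverage_fun_add (circleIntegrable_const M 0 r)
    (CircleIntegrable.fun_sum S fun a _ => hca r a)]
  refine Real.circleAverage_mono ?_
    ((circleIntegrable_const M 0 r).add (CircleIntegrable.fun_sum S fun a _ => hca r a)) ?_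
  · refine (((hcg r hr0.le hrR.le).sub (circleIntegrable_const _ 0 r)).add
      (CircleIntegrable.fun_sum S fun a _ => ?_)).abs
    exact ((circleIntegrable_log_norm_sub_const r).sub
      (circleIntegrable_const (Real.log (max r ‖a‖)) 0 r)).const_smul (a := (D a : ℝ))
  · intro z hz
    have hz' : ‖z‖ = r := by simpa [abs_of_pos hr0] using hz
    refine (abs_add_le _ _).trans (add_le_add ?_ ((Finset.abs_sum_le_sum_abs _ _).trans ?_))
    · have := abs_sub_le_mul_circleAverage_abs_of_harmonicOnNhd hharm κ (w := z) (by linarith)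
      rw [hz'] at this
      refine this.trans (mul_le_mul_of_nonneg_left hbdry ?_)
      have : 0 < R - r := by linarith
      positivity
    · exact Finset.sum_le_sum fun a _ => (abs_mul _ _).le

open Function.locallyFinsuppWithin in
/-- The number of points of an effective divisor in a disc, bounded by the logarithmic counting
function on a larger disc. -/
theorem sum_mul_log_le_logCounting {D : Function.locallyFinsupp ℂ ℤ} (hD : 0 ≤ D)
    {R M : ℝ} (hR : 1 ≤ R) (hM : 1 ≤ M) {S : Finset ℂ} (hS : ∀ a ∈ S, ‖a‖ ≤ R) :
    (∑ a ∈ S, (D a : ℝ)) * Real.log M ≤ logCounting D (M * R) := by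
  classical
  have hR0 : 0 < R := by linarith
  have hM0 : 0 < M := by linarith
  have hMR : R ≤ M * R := le_mul_of_one_le_left hR0.le hM
  have hle : ∑ a ∈ S, single a (D a) ≤ D := by
    intro x
    rw [coe_sum, Finset.sum_apply]
    simp only [single_apply]
    rw [Finset.sum_ite_eq]
    split_ifs
    · exact le_rfl
    · exact hD x
  refine le_trans ?_ (logCounting_le hle (hR.trans hMR))
  rw [map_sum, Finset.sum_apply, Finset.sum_mul]
  refine Finset.sum_le_sum fun a ha => ?_
  rw [logCounting_single_eq_log_sub_const ((hS a ha).trans hMR)]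
  refine mul_le_mul_of_nonneg_left ?_ (Int.cast_nonneg (hD a))
  rw [Real.log_mul hM0.ne' hR0.ne']
  -- At `a = 0` the convention `log 0 = 0` makes this `0 ≤ log R`.
  have : Real.log ‖a‖ ≤ Real.log R := by
    rcases eq_or_ne a 0 with rfl | h0
    · simpa using Real.log_nonneg hR
    · exact Real.log_le_log (norm_pos_iff.2 h0) (hS a ha)
  linarith

/-- Pointwise, `|log x| = log⁺ x + log⁺ x⁻¹`. -/
theorem circleAverage_abs_log_norm_eq {f : ℂ → ℂ} (hf : Meromorphic f) (r : ℝ) :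
    Real.circleAverage (fun z => |Real.log ‖f z‖|) 0 r
      = nevanlinnaProximity f r + nevanlinnaProximity f⁻¹ r := by
  rw [nevanlinnaProximity, nevanlinnaProximity, ValueDistribution.proximity_top,
    ValueDistribution.proximity_top, ← Real.circleAverage_fun_add
      hf.meromorphicOn.circleIntegrable_posLog_norm hf.inv.meromorphicOn.circleIntegrable_posLog_norm]
  congr 1
  ext z
  rw [Pi.inv_apply, norm_inv, ← Real.half_mul_log_add_log_abs, ← Real.half_mul_log_add_log_abs,
    Real.log_inv, abs_neg]
  ring

theorem Meromorphic.comp_const_mul {f : ℂ → ℂ} (hf : Meromorphic f) (p : ℂ) :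
    Meromorphic fun z => f (p * z) := fun x =>
  (hf (p * x)).comp_analyticAt (g := fun z => p * z) (by fun_prop)

/-- Proximity estimate for the quotient `f (p z) / f z`. -/
theorem proximity_comp_mul_div_le {f : ℂ → ℂ} (hf : Meromorphic f)
    (hord : ∀ z, meromorphicOrderAt f z ≠ ⊤) {p : ℂ} (hp : p ≠ 0) {K M r : ℝ} (hK : 4 ≤ K)
    (hM : 1 < M) (hr : 1 ≤ r) (hpr : 1 ≤ ‖p‖ * r) :
    nevanlinnaProximity (fun z => f (p * z) / f z) r ≤
      8 / K * (nevanlinnaCharacteristic f (K * ((1 + ‖p‖) * r))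
          + nevanlinnaCharacteristic f⁻¹ (K * ((1 + ‖p‖) * r)))
        + (8 * Real.log 2 + |Real.log ‖p‖|) / Real.log M
          * (nevanlinnaCharacteristic f (M * (K * ((1 + ‖p‖) * r)))
            + nevanlinnaCharacteristic f⁻¹ (M * (K * ((1 + ‖p‖) * r)))) := by
  have hp0 : 0 < ‖p‖ := norm_pos_iff.2 hp
  have hr0 : 0 < r := by linarith
  have hK0 : 0 < K := by linarith
  -- `s` dominates both radii `r` and `‖p‖ r`; then `R = K s` with `K ≥ 4` gives `2t / (R - t) ≤ 4 /
  -- K ≤ 1` for `t ≤ s`.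
  set s : ℝ := (1 + ‖p‖) * r with hs_def
  set R : ℝ := K * s with hR_def
  have hrs : r ≤ s := by rw [hs_def]; nlinarith [mul_pos hp0 hr0]
  have hps : ‖p‖ * r ≤ s := by rw [hs_def]; linarith
  have hs1 : 1 ≤ s := hr.trans hrs
  have hsR : s < R := by rw [hR_def]; nlinarith
  have hR1 : 1 ≤ R := hs1.trans hsR.le
  have hMR : 1 ≤ M * R := by nlinarith
  set D := MeromorphicOn.divisor f (Metric.closedBall 0 R) with hD_def
  set D' := MeromorphicOn.divisor f Set.univ with hD'_def
  have hfin : (Function.support D).Finite := D.finiteSupport (isCompact_closedBall 0 R)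
  set S := hfin.toFinset
  have hSR : ∀ a ∈ S, ‖a‖ ≤ R := fun a ha => by
    have := D.supportWithinDomain (hfin.mem_toFinset.1 ha)
    simpa using this
  have hDD : ∀ a ∈ S, D a = D' a := fun a ha => by
    rw [hD_def, hD'_def, MeromorphicOn.divisor_apply hf.meromorphicOn (Set.mem_univ a),
      MeromorphicOn.divisor_apply hf.meromorphicOn (by simpa using hSR a ha)]
  set n : ℝ := ∑ a ∈ S, |(D a : ℝ)| with hn_def
  have hn0 : 0 ≤ n := Finset.sum_nonneg fun a _ => abs_nonneg _
  have hlM : 0 < Real.log M := Real.log_pos hM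
  have hl2 : 0 < Real.log 2 := Real.log_pos one_lt_two
  have hn : n * Real.log M ≤ nevanlinnaCharacteristic f (M * R)
      + nevanlinnaCharacteristic f⁻¹ (M * R) := by
    have e1 := sum_mul_log_le_logCounting (posPart_nonneg D') hR1 hM.le hSR
    have e2 := sum_mul_log_le_logCounting (negPart_nonneg D') hR1 hM.le hSR
    have e3 : n = (∑ a ∈ S, ((D'⁺ a : ℤ) : ℝ)) + ∑ a ∈ S, ((D'⁻ a : ℤ) : ℝ) := by
      rw [hn_def, ← Finset.sum_add_distrib]
      refine Finset.sum_congr rfl fun a ha => ?_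
      rw [hDD a ha, ← Int.cast_abs, ← posPart_add_negPart (D' a), Int.cast_add]
      rfl
    rw [← ValueDistribution.logCounting_zero] at e1
    rw [← ValueDistribution.logCounting_top] at e2
    rw [e3, add_mul]
    have e4 : ValueDistribution.logCounting f ⊤ (M * R) ≤ nevanlinnaCharacteristic f (M * R) :=
      le_add_of_nonneg_left (ValueDistribution.proximity_nonneg _)
    have e5 : ValueDistribution.logCounting f 0 (M * R) ≤ nevanlinnaCharacteristic f⁻¹ (M * R) := by
      rw [← ValueDistribution.logCounting_inv]
      exact le_add_of_nonneg_left (ValueDistribution.proximity_nonneg _)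
    linarith
  obtain ⟨c, hc⟩ := exists_circleAverage_abs_log_norm_sub_le hf hord hR1 (S := S)
    (fun a ha => hfin.mem_toFinset.2 ha) hSR
  rw [← hD_def, ← hn_def] at hc
  set A := Real.circleAverage (fun z => |Real.log ‖f z‖|) 0 R with hA_def
  have hA0 : 0 ≤ A := Real.circleAverage_nonneg_of_nonneg fun _ _ => abs_nonneg _
  have hA : A ≤ nevanlinnaCharacteristic f R + nevanlinnaCharacteristic f⁻¹ R := by
    rw [hA_def, circleAverage_abs_log_norm_eq hf]
    exact add_le_add (le_add_of_nonneg_right (ValueDistribution.logCounting_nonneg hR1))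
      (le_add_of_nonneg_right (ValueDistribution.logCounting_nonneg hR1))
  set ℓ : ℝ → ℝ := fun t => c + ∑ a ∈ S, (D a : ℝ) * Real.log (max t ‖a‖) with hℓ_def
  have hosc : ∀ t, 1 ≤ t → t ≤ s →
      Real.circleAverage (fun z => |Real.log ‖f z‖ - ℓ t|) 0 t ≤ 4 / K * A + 4 * Real.log 2 * n := by
    intro t ht hts
    have h1 : 2 * t / (R - t) ≤ 4 / K := by
      rw [div_le_div_iff₀ (by linarith) hK0, hR_def]
      nlinarith
    have h2 : 4 / K ≤ 1 := (div_le_one hK0).2 hK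
    have h3 := hc t ht (hts.trans_lt hsR)
    have h4 : 2 * t / (R - t) * (A + 2 * Real.log 2 * n) ≤ 4 / K * (A + 2 * Real.log 2 * n) :=
      mul_le_mul_of_nonneg_right h1 (by positivity)
    have h5 : 4 / K * (2 * Real.log 2 * n) ≤ 1 * (2 * Real.log 2 * n) :=
      mul_le_mul_of_nonneg_right h2 (by positivity)
    refine h3.trans ?_
    linarith
  have hℓ : |ℓ (‖p‖ * r) - ℓ r| ≤ n * |Real.log ‖p‖| := by
    have : ℓ (‖p‖ * r) - ℓ r
        = ∑ a ∈ S, (D a : ℝ) * (Real.log (max (‖p‖ * r) ‖a‖) - Real.log (max r ‖a‖)) := by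
      simp only [hℓ_def, mul_sub, Finset.sum_sub_distrib]
      ring
    rw [this, hn_def, Finset.sum_mul]
    refine (Finset.abs_sum_le_sum_abs _ _).trans (Finset.sum_le_sum fun a _ => ?_)
    rw [abs_mul]
    refine mul_le_mul_of_nonneg_left ?_ (abs_nonneg _)
    refine (abs_log_max_sub_log_max_le (by positivity) hr0).trans ?_
    rw [Real.log_mul hp0.ne' hr0.ne', add_sub_cancel_right]
  have hfp := hf.comp_const_mul p
  have hi1 : CircleIntegrable (fun z => |Real.log ‖f (p * z)‖ - ℓ (‖p‖ * r)|) 0 r :=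
    (hfp.meromorphicOn.circleIntegrable_log_norm.sub (circleIntegrable_const _ 0 r)).abs
  have hi2 : CircleIntegrable (fun z => |Real.log ‖f z‖ - ℓ r|) 0 r :=
    (hf.meromorphicOn.circleIntegrable_log_norm.sub (circleIntegrable_const _ 0 r)).abs
  have hprox : nevanlinnaProximity (fun z => f (p * z) / f z) r
      ≤ 2 * (4 / K * A + 4 * Real.log 2 * n) + n * |Real.log ‖p‖| := by
    rw [nevanlinnaProximity, ValueDistribution.proximity_top]
    have h1 := hosc (‖p‖ * r) hpr hps
    rw [← circleAverage_comp_mul_left (fun z => |Real.log ‖f z‖ - ℓ (‖p‖ * r)|)] at h1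
    have h2 := hosc r hr hrs
    have h3 : Real.circleAverage (fun z => Real.posLog ‖f (p * z) / f z‖) 0 r
        ≤ Real.circleAverage (fun z => (|Real.log ‖f (p * z)‖ - ℓ (‖p‖ * r)|
          + |Real.log ‖f z‖ - ℓ r|) + |ℓ (‖p‖ * r) - ℓ r|) 0 r := by
      refine Real.circleAverage_mono ?_ ((hi1.add hi2).add (circleIntegrable_const _ 0 r)) ?_
      · exact (hfp.fun_div hf).meromorphicOn.circleIntegrable_posLog_norm
      · intro z _
        rw [Real.posLog]
        refine max_le (by positivity) ?_
        rcases eq_or_ne (f (p * z)) 0 with h0 | h0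
        · rw [h0, zero_div, norm_zero, Real.log_zero]; positivity
        rcases eq_or_ne (f z) 0 with h0' | h0'
        · rw [h0', div_zero, norm_zero, Real.log_zero]; positivity
        rw [norm_div, Real.log_div (norm_ne_zero_iff.2 h0) (norm_ne_zero_iff.2 h0')]
        have a1 := le_abs_self (Real.log ‖f (p * z)‖ - ℓ (‖p‖ * r))
        have a2 := neg_abs_le (Real.log ‖f z‖ - ℓ r)
        have a3 := le_abs_self (ℓ (‖p‖ * r) - ℓ r)
        linarith
    rw [Real.circleAverage_fun_add (f₁ := fun z => |Real.log ‖f (p * z)‖ - ℓ (‖p‖ * r)|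
        + |Real.log ‖f z‖ - ℓ r|) (hi1.add hi2) (circleIntegrable_const _ 0 r),
      Real.circleAverage_fun_add hi1 hi2, Real.circleAverage_const] at h3
    linarith
  refine hprox.trans ?_
  have h1 : 8 / K * A ≤ 8 / K * (nevanlinnaCharacteristic f R + nevanlinnaCharacteristic f⁻¹ R) :=
    mul_le_mul_of_nonneg_left hA (by positivity)
  have h2 : (8 * Real.log 2 + |Real.log ‖p‖|) * n
      ≤ (8 * Real.log 2 + |Real.log ‖p‖|) / Real.log M
          * (nevanlinnaCharacteristic f (M * R) + nevanlinnaCharacteristic f⁻¹ (M * R)) := by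
    rw [div_mul_eq_mul_div, mul_div_assoc]
    exact mul_le_mul_of_nonneg_left ((le_div_iff₀ hlM).2 hn) (by positivity)
  have h3 : 2 * (4 / K * A) = 8 / K * A := by ring
  linarith

/-! ### Growth of the characteristic -/

/-- Identity theorem: infinite order at one point spreads over the connected plane. -/
theorem meromorphicOrderAt_sub_const_ne_top {f : ℂ → ℂ} (hf : Meromorphic f)
    (hconst : ¬ IsMeromorphicConst f) (a z : ℂ) : meromorphicOrderAt (fun w => f w - a) z ≠ ⊤ := by
  have hfa : Meromorphic fun w => f w - a := hf.fun_sub (Meromorphic.const a)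
  intro hz
  refine hconst ⟨a, ?_⟩
  have hall : ∀ x, meromorphicOrderAt (fun w => f w - a) x = ⊤ := by
    by_contra! h
    obtain ⟨x, hx⟩ := h
    exact hfa.meromorphicOn.meromorphicOrderAt_ne_top_of_isPreconnected isPreconnected_univ
      (Set.mem_univ x) (Set.mem_univ z) hx hz
  rw [EventuallyEq, Filter.Eventually, mem_codiscrete]
  intro x
  rw [disjoint_principal_right, compl_compl]
  filter_upwards [meromorphicOrderAt_eq_top_iff.1 (hall x)] with w hw
  exact sub_eq_zero.1 hw

/-- The characteristic of a nonconstant meromorphic function tends to infinity. -/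
theorem tendsto_characteristic_atTop {f : ℂ → ℂ} (hf : Meromorphic f)
    (hconst : ¬ IsMeromorphicConst f) : Tendsto (nevanlinnaCharacteristic f) atTop atTop := by
  classical
  -- A single zero of `f - f z₀` already forces counting of size `log r - O(1)`; the first main
  -- theorem transfers this to `T(r, f)`.
  obtain ⟨z₀, hz₀⟩ := (hf 0).eventually_analyticAt.exists
  set a := f z₀
  set g : ℂ → ℂ := fun w => f w - a
  have hg : Meromorphic g := hf.fun_sub (Meromorphic.const a)
  have hgz : AnalyticAt ℂ g z₀ := hz₀.sub analyticAt_const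
  have hpos : 1 ≤ MeromorphicOn.divisor g Set.univ z₀ := by
    rw [MeromorphicOn.divisor_apply hg.meromorphicOn (Set.mem_univ z₀)]
    have h1 := hgz.meromorphicOrderAt_nonneg
    have h2 : meromorphicOrderAt g z₀ ≠ 0 := fun h =>
      hgz.meromorphicNFAt.meromorphicOrderAt_eq_zero_iff.1 h (sub_self _)
    have h3 := meromorphicOrderAt_sub_const_ne_top hf hconst a z₀
    change meromorphicOrderAt g z₀ ≠ ⊤ at h3
    lift meromorphicOrderAt g z₀ to ℤ using h3 with m
    simp only [WithTop.untop₀_coe]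
    norm_cast at h1 h2
    omega
  have hle : Function.locallyFinsuppWithin.single z₀ 1 ≤ (MeromorphicOn.divisor g Set.univ)⁺ := by
    intro x
    rw [Function.locallyFinsuppWithin.single_apply,
      Function.locallyFinsuppWithin.posPart_apply]
    split_ifs with h
    · rw [h]; exact hpos.trans (le_posPart _)
    · exact posPart_nonneg _
  set C : ℝ := max |Real.log ‖g 0‖| |Real.log ‖meromorphicTrailingCoeffAt g 0‖|
  refine tendsto_atTop_mono' atTop
    (f₁ := fun r => Real.log r + (-(Real.log ‖z₀‖ + C + (Real.posLog ‖a‖ + Real.log 2)))) ?_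
    (tendsto_atTop_add_const_right _ _ Real.tendsto_log_atTop)
  filter_upwards [eventually_ge_atTop 1, eventually_ge_atTop ‖z₀‖] with r hr hrz
  have h1 := Function.locallyFinsuppWithin.logCounting_le hle hr
  rw [Function.locallyFinsuppWithin.logCounting_single_eq_log_sub_const hrz,
    ← ValueDistribution.logCounting_zero, ← ValueDistribution.logCounting_inv, Int.cast_one,
    one_mul] at h1
  have h2 : ValueDistribution.logCounting g⁻¹ ⊤ r ≤ nevanlinnaCharacteristic g⁻¹ r :=
    le_add_of_nonneg_left (ValueDistribution.proximity_nonneg _)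
  have h3 := abs_le.1 (ValueDistribution.characteristic_sub_characteristic_inv_le hg (R := r))
  have h4 := abs_le.1
    (ValueDistribution.abs_characteristic_sub_characteristic_shift_le (a₀ := a) (r := r) hf)
  have h3' := h3.1
  have h4' := h4.1
  change -C ≤ nevanlinnaCharacteristic g r - nevanlinnaCharacteristic g⁻¹ r at h3'
  change _ ≤ nevanlinnaCharacteristic f r - nevanlinnaCharacteristic g r at h4'
  linarith

/-! ### Negligible functions and the induction on `k` -/

/-- `φ` is negligible against `T` along the radii at which `T` satisfies some doubling condition. -/
def IsNegligible (T φ : ℝ → ℝ) : Prop :=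
  ∀ ε > 0, ∃ c, 1 < c ∧ ∀ᶠ r in atTop, T (c * r) ≤ 2 * T r → φ r ≤ ε * T r

theorem isNegligible_proximity_comp_mul_div {f : ℂ → ℂ} (hf : Meromorphic f)
    (hconst : ¬ IsMeromorphicConst f) {p : ℂ} (hp : p ≠ 0) :
    IsNegligible (nevanlinnaCharacteristic f)
      (nevanlinnaProximity fun z => f (p * z) / f z) := by
  have hord : ∀ z, meromorphicOrderAt f z ≠ ⊤ := by
    simpa using meromorphicOrderAt_sub_const_ne_top hf hconst 0
  have hp0 : 0 < ‖p‖ := norm_pos_iff.2 hp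
  intro ε hε
  set C₁ := 8 * Real.log 2 + |Real.log ‖p‖| with hC₁_def
  have hl2 : 0 < Real.log 2 := Real.log_pos one_lt_two
  have hC₁ : 0 < C₁ := by positivity
  set C₀ : ℝ := max |Real.log ‖f 0‖| |Real.log ‖meromorphicTrailingCoeffAt f 0‖|
  -- `K` and `M` make both coefficients in `proximity_comp_mul_div_le` at most `ε / 10`, each to be
  -- multiplied by at most `5 T(r)`.
  set K : ℝ := max 4 (80 / ε)
  set M : ℝ := Real.exp (10 * C₁ / ε) with hM_def
  have hK4 : 4 ≤ K := le_max_left _ _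
  have hK0 : 0 < K := by linarith
  have hM : 1 < M := Real.one_lt_exp_iff.2 (by positivity)
  have hKε : 8 / K ≤ ε / 10 := by
    rw [div_le_div_iff₀ hK0 (by norm_num)]
    have : 80 / ε ≤ K := le_max_right _ _
    rw [div_le_iff₀ hε] at this
    linarith
  have hMε : C₁ / Real.log M = ε / 10 := by
    rw [hM_def, Real.log_exp]
    field_simp
  have hT := ValueDistribution.characteristic_monotoneOn hf
  have hKM : K ≤ M * K := le_mul_of_one_le_left hK0.le hM.le
  have hB : 1 < 1 + ‖p‖ := by linarith
  refine ⟨M * (K * (1 + ‖p‖)), by nlinarith, ?_⟩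
  filter_upwards [eventually_ge_atTop 1, eventually_ge_atTop (1 / ‖p‖),
    (tendsto_characteristic_atTop hf hconst).eventually_ge_atTop C₀,
    (tendsto_characteristic_atTop hf hconst).eventually_ge_atTop 0] with r hr hpr hC hT0 hdouble
  have hpr' : 1 ≤ ‖p‖ * r := by rwa [div_le_iff₀' hp0] at hpr
  have hr0 : 0 < r := by linarith
  refine (proximity_comp_mul_div_le hf hord hp hK4 hM hr hpr').trans ?_
  set R := K * ((1 + ‖p‖) * r) with hR_def
  have hR0 : 0 < R := by positivity
  have hcr : M * (K * (1 + ‖p‖)) * r = M * R := by rw [hR_def]; ring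
  rw [hcr] at hdouble
  have hRM : R ≤ M * R := le_mul_of_one_le_left hR0.le hM.le
  have e1 : nevanlinnaCharacteristic f R ≤ nevanlinnaCharacteristic f (M * R) :=
    hT hR0 (hR0.trans_le hRM) hRM
  have hinv : ∀ t, nevanlinnaCharacteristic f⁻¹ t ≤ nevanlinnaCharacteristic f t + C₀ := by
    intro t
    have := (abs_le.1 (ValueDistribution.characteristic_sub_characteristic_inv_le hf (R := t))).1
    change -C₀ ≤ nevanlinnaCharacteristic f t - nevanlinnaCharacteristic f⁻¹ t at this
    linarith
  have e2 := hinv R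
  have e3 := hinv (M * R)
  rw [hMε]
  -- The 5 is `2 + 2 + 1`: doubling for `f`, the same for `f⁻¹` by the first main theorem, and `C₀ ≤
  -- T(r)`.
  have e4 : nevanlinnaCharacteristic f R + nevanlinnaCharacteristic f⁻¹ R
      ≤ 5 * nevanlinnaCharacteristic f r := by linarith
  have e5 : nevanlinnaCharacteristic f (M * R) + nevanlinnaCharacteristic f⁻¹ (M * R)
      ≤ 5 * nevanlinnaCharacteristic f r := by linarith
  calc _ ≤ 8 / K * (5 * nevanlinnaCharacteristic f r)
        + ε / 10 * (5 * nevanlinnaCharacteristic f r) := by gcongr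
    _ ≤ ε / 10 * (5 * nevanlinnaCharacteristic f r)
        + ε / 10 * (5 * nevanlinnaCharacteristic f r) := by gcongr
    _ = ε * nevanlinnaCharacteristic f r := by ring

namespace IsNegligible

variable {T φ ψ : ℝ → ℝ}

theorem mono (hφ : IsNegligible T φ) (h : ∀ r, ψ r ≤ φ r) : IsNegligible T ψ := by
  intro ε hε
  obtain ⟨c, hc, hr⟩ := hφ ε hε
  exact ⟨c, hc, hr.mono fun r h' hd => (h r).trans (h' hd)⟩

theorem of_const (hT : Tendsto T atTop atTop) (C : ℝ) : IsNegligible T fun _ => C := by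
  intro ε hε
  refine ⟨2, one_lt_two, ?_⟩
  filter_upwards [(hT.const_mul_atTop hε).eventually_ge_atTop C] with r hr _ using hr

/-- Doubling for the larger of two constants implies doubling for both. -/
theorem add (hT : MonotoneOn T (Set.Ioi 0)) (hφ : IsNegligible T φ) (hψ : IsNegligible T ψ) :
    IsNegligible T fun r => φ r + ψ r := by
  intro ε hε
  obtain ⟨c, hc, h1⟩ := hφ (ε / 2) (half_pos hε)
  obtain ⟨d, hd, h2⟩ := hψ (ε / 2) (half_pos hε)
  refine ⟨max c d, lt_max_of_lt_left hc, ?_⟩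
  filter_upwards [h1, h2, eventually_gt_atTop 0] with r h1 h2 hr hdouble
  have hmono : ∀ e, 1 < e → e ≤ max c d → T (e * r) ≤ 2 * T r := fun e he hle =>
    (hT (mul_pos (by linarith) hr) (mul_pos (by linarith) hr)
      (mul_le_mul_of_nonneg_right hle hr.le)).trans hdouble
  have := h1 (hmono c hc (le_max_left _ _))
  have := h2 (hmono d hd (le_max_right _ _))
  linarith

end IsNegligible

theorem meromorphic_jacksonDiffIter (q : ℂ) {f : ℂ → ℂ} (hf : Meromorphic f) (k : ℕ) :
    Meromorphic (jacksonDiffIter q k f) := by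
  induction k with
  | zero => exact hf
  | succ k ih =>
    refine ((ih.comp_const_mul q).fun_sub ih).fun_div fun x => ?_
    fun_prop

/-- The dilation `p` must vary in the induction: `D_q^(k+1) f` at `p z` involves `D_q^k f` at `q p
z` and at `p z`. -/
theorem isNegligible_proximity_jacksonDiffIter (q : ℂ) (hq : q ≠ 0) {f : ℂ → ℂ}
    (hf : Meromorphic f) (hconst : ¬ IsMeromorphicConst f) (k : ℕ) {p : ℂ} (hp : p ≠ 0) :
    IsNegligible (nevanlinnaCharacteristic f)
      (nevanlinnaProximity fun z => jacksonDiffIter q k f (p * z) / f z) := by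
  induction k generalizing p with
  | zero => exact isNegligible_proximity_comp_mul_div hf hconst hp
  | succ k ih =>
    set g := jacksonDiffIter q k f with hg_def
    have hg : Meromorphic g := meromorphic_jacksonDiffIter q hf k
    have hmono := ValueDistribution.characteristic_monotoneOn hf
    have htend := tendsto_characteristic_atTop hf hconst
    set g₁ : ℂ → ℂ := fun z => g (q * p * z) / f z
    set g₂ : ℂ → ℂ := fun z => g (p * z) / f z
    set h : ℂ → ℂ := fun z => (q * (p * z) - p * z)⁻¹
    have hg₁ : Meromorphic g₁ := (hg.comp_const_mul _).fun_div hf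
    have hg₂ : Meromorphic g₂ := (hg.comp_const_mul _).fun_div hf
    have hh : Meromorphic h := fun x => by fun_prop
    have heq : (fun z => jacksonDiffIter q (k + 1) f (p * z) / f z) = h * (g₁ + -g₂) := by
      ext z
      simp only [jacksonDiffIter, jacksonDiff, Pi.mul_apply, Pi.add_apply, Pi.neg_apply, g₁, g₂, h,
        ← hg_def, mul_assoc]
      ring
    rw [heq]
    have hneg : nevanlinnaProximity (-g₂) = nevanlinnaProximity g₂ := by
      simp [nevanlinnaProximity, ValueDistribution.proximity_top]
    have hlarge : ∀ r, 1 ≤ r → nevanlinnaProximity h r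
        ≤ Real.posLog ‖(q * p - p)⁻¹‖ := by
      intro r hr
      rw [nevanlinnaProximity, ValueDistribution.proximity_top]
      refine Real.circleAverage_mono_on_of_le_circle
        hh.meromorphicOn.circleIntegrable_posLog_norm fun z hz => ?_
      have hz' : ‖z‖ = r := by simpa [abs_of_pos (zero_lt_one.trans_le hr)] using hz
      have : h z = (q * p - p)⁻¹ * z⁻¹ := by
        simp only [h, ← mul_inv]
        ring
      refine Real.posLog_le_posLog (norm_nonneg _) ?_
      rw [this, norm_mul, norm_inv z, hz']
      exact mul_le_of_le_one_right (norm_nonneg _) (inv_le_one_of_one_le₀ hr)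
    have key : IsNegligible (nevanlinnaCharacteristic f) fun r =>
        (nevanlinnaProximity g₁ r + nevanlinnaProximity g₂ r)
          + (Real.posLog ‖(q * p - p)⁻¹‖ + Real.log 2) :=
      ((ih (mul_ne_zero hq hp)).add hmono (ih hp)).add hmono (.of_const htend _)
    intro ε hε
    obtain ⟨c, hc, hev⟩ := key ε hε
    refine ⟨c, hc, ?_⟩
    filter_upwards [hev, eventually_ge_atTop 1] with r h1 hr hd
    refine le_trans ?_ (h1 hd)
    have a1 := ValueDistribution.proximity_mul_top_le hh (hg₁.add hg₂.neg) r
    have a2 := ValueDistribution.proximity_add_top_le hg₁ hg₂.neg r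
    have a3 := hlarge r hr
    have a4 := congrFun hneg r
    simp only [Pi.add_apply] at a1 a2
    simp only [nevanlinnaProximity] at *
    linarith

/-! ### The exceptional set and the conclusion -/

theorem eventually_log_characteristic_le {f : ℂ → ℂ} (horder : growthOrder f = 0) {ε : ℝ}
    (hε : 0 < ε) :
    ∀ᶠ r in atTop, Real.log (nevanlinnaCharacteristic f r) ≤ ε * Real.log r := by
  have hlt : growthOrder f < (ε : EReal) := by rw [horder]; exact_mod_cast hε
  filter_upwards [eventually_lt_of_limsup_lt hlt, eventually_gt_atTop 1] with r hr h1
  have : Real.log (nevanlinnaCharacteristic f r) / Real.log r < ε := by exact_mod_cast hr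
  exact ((div_lt_iff₀ (Real.log_pos h1)).1 this).le

theorem theorem2p1 (q : ℂ) (hq0 : q ≠ 0) (hq1 : ‖q‖ ≠ 1)
    (f : ℂ → ℂ) (hf : Meromorphic f) (hconst : ¬ IsMeromorphicConst f)
    (horder : growthOrder f = 0) (k : ℕ) :
    ∃ E : Set ℝ, HasLogDensity E 1 ∧
      (nevanlinnaProximity (fun z => jacksonDiffIter q k f z / f z))
        =o[atTop ⊓ 𝓟 E] (nevanlinnaCharacteristic f) := by
  -- Truncation makes the characteristic monotone and at least 1 on all of `ℝ`, leaving it unchanged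
  -- for large `r`.
  set T : ℝ → ℝ := fun r => max 1 (nevanlinnaCharacteristic f (max r 1)) with hT_def
  have hTf := tendsto_characteristic_atTop hf hconst
  have hmonoOn := ValueDistribution.characteristic_monotoneOn hf
  have hpos : ∀ r : ℝ, (0 : ℝ) < max r 1 := fun r => zero_lt_one.trans_le (le_max_right _ _)
  have hT : Monotone T := fun a b hab =>
    max_le_max_left _ (hmonoOn (hpos a) (hpos b) (max_le_max_right 1 hab))
  have hT1 : ∀ r, 1 ≤ T r := fun r => le_max_left _ _
  have hTeq : ∀ᶠ r in atTop, T r = nevanlinnaCharacteristic f r := by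
    filter_upwards [eventually_ge_atTop 1, hTf.eventually_ge_atTop 1] with r h1 h2
    simp only [hT_def, max_eq_left h1, max_eq_right h2]
  have hTorder : ∀ ε > 0, ∀ᶠ r in atTop, Real.log (T r) ≤ ε * Real.log r := by
    intro ε hε
    filter_upwards [hTeq, eventually_log_characteristic_le horder hε] with r h1 h2
    rwa [h1]
  -- The shift by 2 keeps the dilation above 1; `r ≥ 0` is what makes the sets decrease with `n`.
  set G : ℕ → Set ℝ := fun n => {r | T (((n : ℝ) + 2) * r) ≤ 2 * T r} ∩ Set.Ici 0 with hG_def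
  have hGanti : Antitone G := fun m n hmn r hr => by
    have hmn' : (m : ℝ) ≤ n := by exact_mod_cast hmn
    refine ⟨(hT ?_).trans hr.1, hr.2⟩
    exact mul_le_mul_of_nonneg_right (by linarith) hr.2
  have hGd : ∀ n, HasLogDensity (G n) 1 := by
    intro n
    have hn : (1 : ℝ) < (n : ℝ) + 2 := by
      have : (0 : ℝ) ≤ n := n.cast_nonneg
      linarith
    obtain ⟨h1, h2⟩ := hasLogDensity_setOf_le_two_mul hT hT1 hTorder hn
    refine ⟨h1.inter measurableSet_Ici, h2.congr fun r => ?_⟩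
    have : Set.Ici (0 : ℝ) ∩ Set.Icc 1 r = Set.Icc 1 r :=
      Set.inter_eq_right.2 fun t ht => zero_le_one.trans ht.1
    rw [hG_def, Set.inter_assoc, this]
  obtain ⟨E, hE, hEG⟩ := exists_hasLogDensity_one_forall_eventually hGanti hGd
  refine ⟨E, hE, isLittleO_iff.2 fun ε hε => ?_⟩
  obtain ⟨c, hc, hev⟩ := isNegligible_proximity_jacksonDiffIter q hq0 hf hconst k one_ne_zero ε hε
  obtain ⟨n, hn⟩ := exists_nat_ge c
  have hcr : Tendsto (fun r : ℝ => c * r) atTop atTop :=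
    tendsto_id.const_mul_atTop (by linarith)
  rw [eventually_inf_principal]
  filter_upwards [hev, hEG n, hTeq, hcr.eventually hTeq, hTf.eventually_ge_atTop 0]
    with r h1 h2 h3 h4 h5 hrE
  obtain ⟨h6, h7⟩ := h2 hrE
  have h8 : T (c * r) ≤ 2 * T r :=
    (hT (mul_le_mul_of_nonneg_right (by linarith) h7)).trans h6
  rw [h3, h4] at h8
  have h9 := h1 h8
  simp only [one_mul] at h9
  rwa [Real.norm_of_nonneg (ValueDistribution.proximity_nonneg r), Real.norm_of_nonneg h5]
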